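/- Let $G=\prod_{j\in\mathbb N} Z_2$ be the Walsh (dyadic) group, i.e. the set of all sequences $x=(x_0,x_1,\dots)$ with $x_j\in Z_2=\{0,1\}$ under coordinatewise addition modulo $2$, with normalized Haar measure $\mu$. For $n\in\mathbb N=\{0,1,2,\dots\}$ let $\zeta_n$ be the $\sigma$-algebra generated by the dyadic intervals $I_n(x)=\{y\in G: y_0=x_0,\dots,y_{n-1}=x_{n-1}\}$, $x\in G$. For $n=\sum_j n_j2^j$ with $n_j\in\{0,1\}$ let $w_n(x)=\prod_{j}(-1)^{n_jx_j}$ be the $n$-th Walsh function. For a real martingale $F=(F_n)_{n\in\mathbb N}$ with respect to $(\zeta_n)_{n\in\mathbb N}$ put $$\widehat F(k)=\lim_{n\to\infty}\int_G F_n w_k\,d\mu,\qquad S_nF=\sum_{k=0}^{n-1}\widehat F(k)w_k,\qquad \sigma_nF=\frac1n\sum_{k=1}^{n}S_kF\quad(n\ge 1),$$ $\|f\|_{1/2}=\left(\int_G|f|^{1/2}\,d\mu\right)^{2}$ and $\|F\|_{H_{1/2}}=\left\|\sup_{n\in\mathbb N}|F_n|\right\|_{1/2}$. The martingale Hardy space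 $H_{1/2}(G)$ consists of all such $F$ with $\|F\|_{H_{1/2}}<\infty$. For $s\in\mathbb N$ and $0\le k\le s-1$ let $\beta_k^s=2^s+2^{s-1}+\dots+2^k$. Then the restricted maximal operator $$\tilde\sigma_5^{*,\nabla}F:=\sup_{s\in\mathbb N}\ \sup_{0\le k\le s-1}\frac{|\sigma_{\beta_k^s}F|}{\log^2\beta_k^s}$$ is bounded from $H_{1/2}(G)$ to $L_{1/2}(G)$: there is an absolute constant $C<\infty$ such that for every $F\in H_{1/2}(G)$ one has $\tilde\sigma_5^{*,\nabla}F\in L_{1/2}(G)$ and $$\left\|\tilde\sigma_5^{*,\nabla}F\right\|_{1/2}\le C\,\|F\|_{H_{1/2}}.$$ -/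

import Mathlib

open MeasureTheory Filter
open scoped ENNReal NNReal

namespace WalshFejer

noncomputable section

/-- The Walsh (dyadic) group: the complete direct product of countably many copies of `Z_2`. -/
abbrev G : Type := ℕ → ZMod 2

/-- The Haar measure of `Z_2`, giving mass `1/2` to each of the two singletons. -/
def muZ2 : Measure (ZMod 2) :=
  (2⁻¹ : ℝ≥0∞) • (Measure.dirac 0 + Measure.dirac 1)

instance : IsProbabilityMeasure muZ2 := by
  constructor
  simp [muZ2, ENNReal.inv_two_add_inv_two]

/-- The normalized Haar measure on `G`: the product of the Haar measures of the factors. -/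
def haar : Measure G := Measure.infinitePi (fun _ : ℕ => muZ2)

instance : IsProbabilityMeasure haar := by
  unfold haar
  infer_instance

/-- The dyadic interval `I_n(x)`: all `y ∈ G` with `y_0 = x_0, …, y_{n-1} = x_{n-1}`. -/
def dyadicInterval (n : ℕ) (x : G) : Set G := {y | ∀ i, i < n → y i = x i}

theorem measurableSet_dyadicInterval (n : ℕ) (x : G) :
    MeasurableSet (dyadicInterval n x) := by
  have h : dyadicInterval n x = ⋂ i ∈ Set.Iio n, (fun y : G => y i) ⁻¹' {x i} := by
    ext y
    simp [dyadicInterval]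
  rw [h]
  refine MeasurableSet.biInter (Set.to_countable _) fun i _ => ?_
  exact measurable_pi_apply i (MeasurableSet.singleton _)

theorem dyadicInterval_eq_union (n : ℕ) (x : G) :
    dyadicInterval n x = dyadicInterval (n + 1) (Function.update x n 0) ∪
      dyadicInterval (n + 1) (Function.update x n 1) := by
  ext y
  have hz : ∀ z : ZMod 2, z = 0 ∨ z = 1 := by decide
  have key : ∀ b : ZMod 2, y ∈ dyadicInterval (n + 1) (Function.update x n b) ↔
      y ∈ dyadicInterval n x ∧ y n = b := by
    intro b
    constructor
    · intro h
      refine ⟨fun i hi => ?_, ?_⟩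
      · have := h i (by omega)
        rwa [Function.update_of_ne (by omega)] at this
      · simpa using h n (by omega)
    · rintro ⟨h, hb⟩ i hi
      rcases Nat.lt_succ_iff_lt_or_eq.mp hi with h' | rfl
      · rw [Function.update_of_ne (by omega)]
        exact h i h'
      · simpa using hb
  rw [Set.mem_union, key, key]
  have := hz (y n)
  tauto

/-- The dyadic filtration: `ζ_n` is the `σ`-algebra generated by the intervals `I_n(x)`, `x ∈ G`. -/
def dyadicFiltration : Filtration ℕ (inferInstance : MeasurableSpace G) where
  seq n := MeasurableSpace.generateFrom (Set.range (dyadicInterval n))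
  mono' := by
    refine monotone_nat_of_le_succ fun n => ?_
    refine MeasurableSpace.generateFrom_le ?_
    rintro _ ⟨x, rfl⟩
    rw [dyadicInterval_eq_union]
    exact MeasurableSet.union
      (MeasurableSpace.measurableSet_generateFrom ⟨_, rfl⟩)
      (MeasurableSpace.measurableSet_generateFrom ⟨_, rfl⟩)
  le' n := by
    refine MeasurableSpace.generateFrom_le ?_
    rintro _ ⟨x, rfl⟩
    exact measurableSet_dyadicInterval n x

/-- The Rademacher functions `r_k(x) = (-1)^{x_k}`. -/
def rademacher (k : ℕ) (x : G) : ℝ := (-1) ^ (x k).val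

/-- The Walsh functions `w_n = ∏_k r_k ^ {n_k}`, where `n = ∑_k n_k 2^k` with `n_k ∈ {0, 1}`.
Only indices `k < n` matter, since `n_k = 0` whenever `n < 2^k`. -/
def walsh (n : ℕ) (x : G) : ℝ :=
  ∏ k ∈ Finset.range n, rademacher k x ^ (n.testBit k).toNat

/-- The Walsh–Fourier coefficients of a martingale `F = (F_n)`:
`F^(k) = lim_n ∫ F_n w_k dμ`; the sequence is eventually constant when `F` is a dyadic
martingale. -/
def fourierCoeff (F : ℕ → G → ℝ) (k : ℕ) : ℝ :=
  limUnder atTop (fun n => ∫ x, F n x * walsh k x ∂haar)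

/-- The partial sums `S_n F = ∑_{k < n} F^(k) w_k` of the Walsh–Fourier series. -/
def partialSum (F : ℕ → G → ℝ) (n : ℕ) (x : G) : ℝ :=
  ∑ k ∈ Finset.range n, fourierCoeff F k * walsh k x

/-- The Fejér means `σ_n F = (1/n) ∑_{k=1}^n S_k F`. -/
def fejerMean (F : ℕ → G → ℝ) (n : ℕ) (x : G) : ℝ :=
  (1 / (n : ℝ)) * ∑ k ∈ Finset.Icc 1 n, partialSum F k x

/-- The maximal function `F^* = sup_n |F_n|` (with values in `[0, ∞]`). -/
def maximalFunction (F : ℕ → G → ℝ) (x : G) : ℝ≥0∞ := ⨆ n, ENNReal.ofReal |F n x|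

/-- The quasi-norm `‖F‖_{H_p} = ‖F^*‖_p` of the martingale Hardy space. -/
def hardyNorm (p : ℝ≥0∞) (F : ℕ → G → ℝ) : ℝ≥0∞ := eLpNorm (maximalFunction F) p haar

/-- Membership in the martingale Hardy space `H_p(G)`. -/
structure MemHardy (p : ℝ≥0∞) (F : ℕ → G → ℝ) : Prop where
  martingale : Martingale F dyadicFiltration haar
  norm_lt_top : hardyNorm p F < ∞

/-- `β_k^s = 2^s + 2^{s-1} + ⋯ + 2^k`. -/
def betaNum (s k : ℕ) : ℕ := ∑ j ∈ Finset.Icc k s, 2 ^ j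

/-- The restricted weighted maximal operator
`sup_s sup_{0 ≤ k ≤ s-1} |σ_{β_k^s} F| / log² β_k^s` (with values in `[0, ∞]`). -/
def restrictedMaximal (F : ℕ → G → ℝ) (x : G) : ℝ≥0∞ :=
  ⨆ (s : ℕ) (k : ℕ) (_ : k < s),
    ENNReal.ofReal (|fejerMean F (betaNum s k) x| / Real.log (betaNum s k : ℝ) ^ 2)

end

end WalshFejer

/-!
For `n = 2^k` the kernel identity `2 n K_n = D_n + Σ_{j ≤ k} 2^j D_n(· + e_j)` is exact. Splitting
off binary digits, `N |K_N|` is then at most twice the sum of these translated Dirichlet kernels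
over `k < m`, whenever `N < 2^m`. Hence `|σ_N F| = |F_m * K_N|` is bounded by weighted translates of
averages of `|F_m|` over dyadic intervals of rank `k < m`.

Write `|F_m| = u_m²`. If `d` is constant on the intervals of rank `n`, averaging `d²` over an
interval of rank `k` costs at most a factor `2^{n-k}` compared with squaring the average of `d`, and
for `n ≤ m` the kernel weights `2^{j-m}` absorb this factor with a geometric gain `2^{j-k}`.
So the `L²` norm of `d(x + ·)` against the kernel majorant is at most `m` times a function of `x`
that is independent of `m` and whose integral is at most `12 ∫ d`. Minkowski's inequality in `L²`
sums these bounds over the increments `d` of the running maximum of `u_0, u_1, …`, whose integrals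
add up to `∫ sup_n u_n`. The factor `m²` arising in `|σ_N F|` is comparable to `log² N`.
-/

namespace WalshFejer

/-! ### Walsh functions and kernels -/

theorem rademacher_eq_ite (k : ℕ) (x : G) : rademacher k x = if x k = 0 then 1 else -1 := by
  by_cases h : x k = 0
  · simp [rademacher, h]
  · have h_one : x k = 1 := Fin.eq_one_of_ne_zero _ h
    simp [rademacher, h_one, ZMod.val_one]

theorem rademacher_add (k : ℕ) (x y : G) :
    rademacher k (x + y) = rademacher k x * rademacher k y := by
  simp only [rademacher, Pi.add_apply, ZMod.val_add]
  rw [← pow_add, ← neg_one_pow_eq_pow_mod_two]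

theorem abs_rademacher (k : ℕ) (x : G) : |rademacher k x| = 1 := by
  simp [rademacher]

theorem walsh_eq_prod_range {n M : ℕ} (h : n < 2 ^ M) (x : G) :
    walsh n x = ∏ k ∈ Finset.range M, rademacher k x ^ (n.testBit k).toNat := by
  have extend {A B : ℕ} (hA : n < 2 ^ A) (hAB : A ≤ B) :
      ∏ k ∈ Finset.range A, rademacher k x ^ (n.testBit k).toNat =
        ∏ k ∈ Finset.range B, rademacher k x ^ (n.testBit k).toNat := by
    refine Finset.prod_subset (Finset.range_mono hAB) fun k _ hk => ?_
    have hAk : A ≤ k := by simpa using hk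
    simp [Nat.testBit_lt_two_pow (hA.trans_le (Nat.pow_le_pow_right two_pos hAk))]
  rcases le_total n M with hnM | hMn
  · exact extend Nat.lt_two_pow_self hnM
  · exact (extend h hMn).symm

theorem walsh_two_pow_add {k i : ℕ} (hi : i < 2 ^ k) (x : G) :
    walsh (2 ^ k + i) x = rademacher k x * walsh i x := by
  have hlt : 2 ^ k + i < 2 ^ (k + 1) := by rw [pow_succ]; omega
  rw [walsh_eq_prod_range hlt, walsh_eq_prod_range hi, Finset.prod_range_succ, mul_comm,
    Nat.testBit_two_pow_add_eq, Nat.testBit_lt_two_pow hi]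
  congr 1
  · simp
  · refine Finset.prod_congr rfl fun j hj => ?_
    rw [Nat.testBit_two_pow_add_gt (Finset.mem_range.mp hj)]

theorem walsh_add (n : ℕ) (x y : G) : walsh n (x + y) = walsh n x * walsh n y := by
  simp [walsh, rademacher_add, mul_pow, Finset.prod_mul_distrib]

theorem abs_walsh (n : ℕ) (x : G) : |walsh n x| = 1 := by
  simp [walsh, Finset.abs_prod, abs_pow, abs_rademacher]

/-- The element `e_j` of `G` whose only non-zero coordinate is the `j`-th. -/
def unitVec (j : ℕ) : G := Pi.single j 1

theorem add_unitVec_of_ne {i j : ℕ} (h : i ≠ j) (x : G) : (x + unitVec j) i = x i := by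
  simp [unitVec, h]

theorem rademacher_add_unitVec_self (j : ℕ) (x : G) :
    rademacher j (x + unitVec j) = -rademacher j x := by
  rw [rademacher_add, rademacher_eq_ite j (unitVec j)]
  simp [unitVec]

theorem rademacher_add_unitVec_of_ne {i j : ℕ} (h : i ≠ j) (x : G) :
    rademacher i (x + unitVec j) = rademacher i x := by
  simp only [rademacher, add_unitVec_of_ne h]

/-- The Walsh–Dirichlet kernel `D_n = w_0 + ⋯ + w_{n-1}`. -/
noncomputable def dirichletKernel (n : ℕ) (x : G) : ℝ := ∑ i ∈ Finset.range n, walsh i x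

/-- The unnormalized Walsh–Fejér kernel `n K_n = D_1 + ⋯ + D_n`. -/
noncomputable def fejerSum (n : ℕ) (x : G) : ℝ :=
  ∑ k ∈ Finset.range n, dirichletKernel (k + 1) x

theorem dirichletKernel_two_pow_add {k r : ℕ} (hr : r ≤ 2 ^ k) (x : G) :
    dirichletKernel (2 ^ k + r) x =
      dirichletKernel (2 ^ k) x + rademacher k x * dirichletKernel r x := by
  rw [dirichletKernel, Finset.sum_range_add, dirichletKernel, dirichletKernel, Finset.mul_sum]
  congr 1
  exact Finset.sum_congr rfl fun i hi =>
    walsh_two_pow_add ((Finset.mem_range.mp hi).trans_le hr) x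

theorem dirichletKernel_two_pow_succ (n : ℕ) (x : G) :
    dirichletKernel (2 ^ (n + 1)) x = (1 + rademacher n x) * dirichletKernel (2 ^ n) x := by
  rw [pow_succ, mul_two, dirichletKernel_two_pow_add le_rfl]
  ring

theorem dirichletKernel_two_pow (n : ℕ) :
    dirichletKernel (2 ^ n) = (dyadicInterval n 0).indicator fun _ => 2 ^ n := by
  classical
  ext x
  simp only [Set.indicator_apply, dyadicInterval, Set.mem_ofPred_eq, Pi.zero_apply]
  induction n with
  | zero => simp [dirichletKernel, walsh]
  | succ n ih =>
    rw [dirichletKernel_two_pow_succ, ih, rademacher_eq_ite]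
    simp only [Nat.forall_lt_succ_right, pow_succ]
    split_ifs <;> first | tauto | norm_num [mul_comm]

theorem dirichletKernel_two_pow_nonneg (n : ℕ) (x : G) : 0 ≤ dirichletKernel (2 ^ n) x := by
  rw [dirichletKernel_two_pow]
  exact Set.indicator_nonneg (fun _ _ => by positivity) x

theorem dirichletKernel_two_pow_add_unitVec {n j : ℕ} (h : n ≤ j) (x : G) :
    dirichletKernel (2 ^ n) (x + unitVec j) = dirichletKernel (2 ^ n) x := by
  refine Finset.sum_congr rfl fun i hi => ?_
  rw [walsh_eq_prod_range (Finset.mem_range.mp hi), walsh_eq_prod_range (Finset.mem_range.mp hi)]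
  refine Finset.prod_congr rfl fun k hk => ?_
  rw [rademacher_add_unitVec_of_ne ((Finset.mem_range.mp hk).trans_le h).ne]

theorem fejerSum_two_pow_add {k r : ℕ} (hr : r ≤ 2 ^ k) (x : G) :
    fejerSum (2 ^ k + r) x =
      fejerSum (2 ^ k) x + r * dirichletKernel (2 ^ k) x + rademacher k x * fejerSum r x := by
  have shift : ∀ i ∈ Finset.range r, dirichletKernel (2 ^ k + i + 1) x =
      dirichletKernel (2 ^ k) x + rademacher k x * dirichletKernel (i + 1) x := fun i hi => by
    rw [add_assoc, dirichletKernel_two_pow_add ((Finset.mem_range.mp hi).trans_le hr)]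
  rw [fejerSum, Finset.sum_range_add, Finset.sum_congr rfl shift, Finset.sum_add_distrib,
    ← Finset.mul_sum, Finset.sum_const, Finset.card_range, nsmul_eq_mul, ← add_assoc]
  rfl

/-- `Σ_{j ≤ k} 2^j D_{2^k}(x + e_j)`, which is nonnegative and dominates `2^k K_{2^k}`. -/
noncomputable def fejerBlock (k : ℕ) (x : G) : ℝ :=
  ∑ j ∈ Finset.range (k + 1), 2 ^ j * dirichletKernel (2 ^ k) (x + unitVec j)

theorem fejerBlock_nonneg (k : ℕ) (x : G) : 0 ≤ fejerBlock k x :=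
  Finset.sum_nonneg fun _ _ => mul_nonneg (by positivity) (dirichletKernel_two_pow_nonneg _ _)

theorem fejerBlock_succ (k : ℕ) (x : G) :
    fejerBlock (k + 1) x = (1 + rademacher k x) * fejerBlock k x +
      2 ^ (k + 1) * dirichletKernel (2 ^ k) x := by
  have off_diagonal : ∀ j ∈ Finset.range k,
      (2 : ℝ) ^ j * dirichletKernel (2 ^ (k + 1)) (x + unitVec j) =
        (1 + rademacher k x) * (2 ^ j * dirichletKernel (2 ^ k) (x + unitVec j)) := fun j hj => by
    rw [dirichletKernel_two_pow_succ,
      rademacher_add_unitVec_of_ne (Finset.mem_range.mp hj).ne']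
    ring
  rw [fejerBlock, fejerBlock, Finset.sum_range_succ, Finset.sum_range_succ,
    Finset.sum_range_succ, Finset.sum_congr rfl off_diagonal, ← Finset.mul_sum,
    dirichletKernel_two_pow_add_unitVec le_rfl, dirichletKernel_two_pow_succ,
    dirichletKernel_two_pow_succ, dirichletKernel_two_pow_add_unitVec le_rfl,
    rademacher_add_unitVec_self]
  ring

theorem two_mul_fejerSum_two_pow (k : ℕ) (x : G) :
    2 * fejerSum (2 ^ k) x = dirichletKernel (2 ^ k) x + fejerBlock k x := by
  induction k with
  | zero => norm_num [fejerSum, fejerBlock, dirichletKernel, walsh]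
  | succ k ih =>
    rw [dirichletKernel_two_pow_succ, fejerBlock_succ]
    rw [pow_succ, mul_two, fejerSum_two_pow_add le_rfl]
    push_cast
    linear_combination (1 + rademacher k x) * ih

theorem two_pow_mul_dirichletKernel_le_fejerBlock (k : ℕ) (x : G) :
    2 ^ k * dirichletKernel (2 ^ k) x ≤ fejerBlock k x := by
  rw [← dirichletKernel_two_pow_add_unitVec le_rfl x]
  exact Finset.single_le_sum
    (f := fun j => 2 ^ j * dirichletKernel (2 ^ k) (x + unitVec j))
    (fun _ _ => mul_nonneg (by positivity) (dirichletKernel_two_pow_nonneg _ _))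
    (Finset.self_mem_range_succ k)

theorem fejerSum_two_pow_le_fejerBlock (k : ℕ) (x : G) :
    fejerSum (2 ^ k) x ≤ fejerBlock k x := by
  have hD : dirichletKernel (2 ^ k) x ≤ 2 ^ k * dirichletKernel (2 ^ k) x :=
    le_mul_of_one_le_left (dirichletKernel_two_pow_nonneg k x) (one_le_pow₀ one_le_two)
  linarith [two_mul_fejerSum_two_pow k x, two_pow_mul_dirichletKernel_le_fejerBlock k x]

theorem fejerSum_two_pow_nonneg (k : ℕ) (x : G) : 0 ≤ fejerSum (2 ^ k) x := by
  linarith [two_mul_fejerSum_two_pow k x, dirichletKernel_two_pow_nonneg k x,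
    fejerBlock_nonneg k x]

/-- The sum of the first `m` Fejér blocks; `2 * fejerMajorant m` dominates `|D_1 + ⋯ + D_N|` for
`N < 2^m`. -/
noncomputable def fejerMajorant (m : ℕ) (x : G) : ℝ := ∑ k ∈ Finset.range m, fejerBlock k x

theorem fejerMajorant_succ (m : ℕ) (x : G) :
    fejerMajorant (m + 1) x = fejerMajorant m x + fejerBlock m x :=
  Finset.sum_range_succ _ _

theorem abs_fejerSum_le {N m : ℕ} (h : N < 2 ^ m) (x : G) :
    |fejerSum N x| ≤ 2 * fejerMajorant m x := by
  induction m generalizing N with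
  | zero =>
    obtain rfl : N = 0 := by simpa using h
    simp [fejerSum, fejerMajorant]
  | succ m ih =>
    rw [fejerMajorant_succ]
    rcases lt_or_ge N (2 ^ m) with hN | hN
    · linarith [ih hN, fejerBlock_nonneg m x]
    obtain ⟨r, rfl⟩ := Nat.exists_eq_add_of_le hN
    have hr : r < 2 ^ m := by rw [pow_succ] at h; omega
    have hrD : |r * dirichletKernel (2 ^ m) x| ≤ fejerBlock m x := by
      rw [abs_of_nonneg (mul_nonneg r.cast_nonneg (dirichletKernel_two_pow_nonneg m x))]
      refine le_trans ?_ (two_pow_mul_dirichletKernel_le_fejerBlock m x)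
      exact mul_le_mul_of_nonneg_right (by exact_mod_cast hr.le)
        (dirichletKernel_two_pow_nonneg m x)
    calc |fejerSum (2 ^ m + r) x|
        ≤ |fejerSum (2 ^ m) x| + |r * dirichletKernel (2 ^ m) x| +
            |rademacher m x * fejerSum r x| := by
          rw [fejerSum_two_pow_add hr.le]
          exact abs_add_three _ _ _
      _ ≤ fejerBlock m x + fejerBlock m x + 2 * fejerMajorant m x := by
          rw [abs_of_nonneg (fejerSum_two_pow_nonneg m x), abs_mul (rademacher m x),
            abs_rademacher, one_mul]
          exact add_le_add_three (fejerSum_two_pow_le_fejerBlock m x) hrD (ih hr)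
      _ = 2 * (fejerMajorant m x + fejerBlock m x) := by ring

/-! ### Haar measure and averages over dyadic intervals -/

theorem dyadicInterval_anti {m n : ℕ} (h : m ≤ n) (x : G) :
    dyadicInterval n x ⊆ dyadicInterval m x :=
  fun _ hy i hi => hy i (hi.trans_le h)

theorem dyadicInterval_eq_of_mem {n : ℕ} {x y : G} (h : y ∈ dyadicInterval n x) :
    dyadicInterval n y = dyadicInterval n x := by
  ext z
  exact ⟨fun hz i hi => (hz i hi).trans (h i hi), fun hz i hi => (hz i hi).trans (h i hi).symm⟩

theorem add_mem_dyadicInterval_add_iff {n : ℕ} (x : G) {y z : G} :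
    x + z ∈ dyadicInterval n (x + y) ↔ z ∈ dyadicInterval n y := by
  simp [dyadicInterval]

theorem add_mem_dyadicInterval_iff {n : ℕ} (x : G) {y : G} :
    x + y ∈ dyadicInterval n x ↔ y ∈ dyadicInterval n 0 := by
  simp [dyadicInterval]

theorem add_unitVec_mem_dyadicInterval {n j : ℕ} (h : n ≤ j) (x : G) :
    x + unitVec j ∈ dyadicInterval n x :=
  fun _ hi => add_unitVec_of_ne (hi.trans_le h).ne x

theorem muZ2_singleton (a : ZMod 2) : muZ2 {a} = 2⁻¹ := by
  obtain rfl | rfl : a = 0 ∨ a = 1 := by revert a; decide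
  all_goals simp [muZ2]

theorem haar_dyadicInterval (n : ℕ) (x : G) : haar (dyadicInterval n x) = 2⁻¹ ^ n := by
  have h_pi : dyadicInterval n x = (Finset.range n : Set ℕ).pi fun i => {x i} := by
    ext y
    simp [dyadicInterval, Set.mem_pi]
  rw [h_pi, haar, Measure.infinitePi_pi _ fun i _ => MeasurableSet.singleton _]
  simp [muZ2_singleton]

instance : muZ2.IsAddLeftInvariant where
  map_add_left_eq_self a := by
    refine Measure.ext_of_singleton fun b => ?_
    rw [Measure.map_apply (measurable_of_countable _) (MeasurableSet.singleton b),
      Set.preimage_add_left_singleton, muZ2_singleton, muZ2_singleton]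

instance : haar.IsAddLeftInvariant where
  map_add_left_eq_self a := by
    have h_pi := Measure.infinitePi_map_pi (fun _ : ℕ => muZ2)
      (f := fun i b => a i + b) fun i => measurable_of_countable _
    simp only [map_add_left_eq_self] at h_pi
    exact h_pi

theorem two_pow_mul_inv_two_pow (k : ℕ) : (2 : ℝ≥0∞) ^ k * 2⁻¹ ^ k = 1 := by
  rw [← mul_pow, ENNReal.mul_inv_cancel two_ne_zero ENNReal.ofNat_ne_top, one_pow]

/-- The average of `f` over `I_k(x) = x + I_k(0)`, i.e. the conditional expectation of `f` given
`ζ_k`, as a function defined everywhere. -/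
noncomputable def dyadicAverage (k : ℕ) (f : G → ℝ≥0∞) (x : G) : ℝ≥0∞ :=
  ⨍⁻ y in dyadicInterval k 0, f (x + y) ∂haar

theorem dyadicAverage_eq_mul_lintegral (k : ℕ) (f : G → ℝ≥0∞) (x : G) :
    dyadicAverage k f x = 2 ^ k * ∫⁻ y in dyadicInterval k 0, f (x + y) ∂haar := by
  rw [dyadicAverage, setLAverage_eq, haar_dyadicInterval, ENNReal.div_eq_inv_mul,
    ← ENNReal.inv_pow, inv_inv]

theorem measurable_dyadicAverage (k : ℕ) {f : G → ℝ≥0∞} (hf : Measurable f) :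
    Measurable (dyadicAverage k f) :=
  Measurable.lintegral_prod_right' (hf.comp measurable_add)

theorem lintegral_dyadicAverage (k : ℕ) {f : G → ℝ≥0∞} (hf : Measurable f) :
    ∫⁻ x, dyadicAverage k f x ∂haar = ∫⁻ x, f x ∂haar := by
  simp_rw [dyadicAverage_eq_mul_lintegral]
  have h_meas : Measurable (Function.uncurry fun x y : G => f (x + y)) := hf.comp measurable_add
  rw [lintegral_const_mul' _ _ (by finiteness),
    lintegral_lintegral_swap h_meas.aemeasurable]
  simp only [lintegral_add_right_eq_self f, setLIntegral_const, haar_dyadicInterval]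
  rw [mul_left_comm, two_pow_mul_inv_two_pow, mul_one]

theorem mem_of_mem_dyadicInterval {n : ℕ} {A : Set G} (hA : MeasurableSet[dyadicFiltration n] A)
    {x y : G} (hxy : y ∈ dyadicInterval n x) : y ∈ A ↔ x ∈ A := by
  induction A, hA using MeasurableSpace.generateFrom_induction with
  | hC A hA _ =>
    obtain ⟨z, rfl⟩ := hA
    have shift {u v : G} (h : u ∈ dyadicInterval n v) (hu : u ∈ dyadicInterval n z) :
        v ∈ dyadicInterval n z := fun i hi => (h i hi).symm.trans (hu i hi)
    exact ⟨shift hxy, shift fun i hi => (hxy i hi).symm⟩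
  | empty => simp
  | compl A _ ih => exact not_congr ih
  | iUnion A _ ih => simp only [Set.mem_iUnion, ih]

theorem eq_of_mem_dyadicInterval {β : Type*} [MeasurableSpace β] [MeasurableSingletonClass β]
    {n : ℕ} {f : G → β} (hf : Measurable[dyadicFiltration n] f) {x y : G}
    (hxy : y ∈ dyadicInterval n x) : f y = f x :=
  (mem_of_mem_dyadicInterval (hf (MeasurableSet.singleton (f x))) hxy).mpr rfl

theorem dyadicAverage_of_le {n k : ℕ} (h : n ≤ k) {d : G → ℝ≥0∞}
    (hd : Measurable[dyadicFiltration n] d) (x : G) : dyadicAverage k d x = d x := by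
  have h_const : Set.EqOn (fun y => d (x + y)) (fun _ => d x) (dyadicInterval k 0) := fun y hy =>
    eq_of_mem_dyadicInterval hd
      (dyadicInterval_anti h x ((add_mem_dyadicInterval_iff x).mpr hy))
  rw [dyadicAverage_eq_mul_lintegral,
    setLIntegral_congr_fun (measurableSet_dyadicInterval k 0) h_const, setLIntegral_const,
    haar_dyadicInterval, mul_left_comm, two_pow_mul_inv_two_pow, mul_one]

theorem le_two_pow_mul_dyadicAverage {n k : ℕ} {d : G → ℝ≥0∞}
    (hd : Measurable[dyadicFiltration n] d) (x : G) {y : G} (hy : y ∈ dyadicInterval k 0) :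
    d (x + y) ≤ 2 ^ (n - k) * dyadicAverage k d x := by
  have h_subset : dyadicInterval (n - k + k) y ⊆ dyadicInterval k 0 :=
    (dyadicInterval_anti (Nat.le_add_left k _) y).trans (dyadicInterval_eq_of_mem hy).subset
  have h_const : Set.EqOn (fun z => d (x + z)) (fun _ => d (x + y))
      (dyadicInterval (n - k + k) y) := fun z hz =>
    eq_of_mem_dyadicInterval hd
      (dyadicInterval_anti (by omega) _ ((add_mem_dyadicInterval_add_iff x).mpr hz))
  calc d (x + y)
      = 2 ^ (n - k) * (2 ^ k * ∫⁻ z in dyadicInterval (n - k + k) y, d (x + z) ∂haar) := by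
        rw [setLIntegral_congr_fun (measurableSet_dyadicInterval _ y) h_const, setLIntegral_const,
          haar_dyadicInterval, ← mul_assoc, ← pow_add, mul_left_comm, two_pow_mul_inv_two_pow,
          mul_one]
    _ ≤ 2 ^ (n - k) * dyadicAverage k d x := by
        rw [dyadicAverage_eq_mul_lintegral]
        gcongr

theorem dyadicAverage_sq_le {n : ℕ} (k : ℕ) {d : G → ℝ≥0∞}
    (hd : Measurable[dyadicFiltration n] d) (x : G) :
    dyadicAverage k (fun y => d y ^ 2) x ≤ 2 ^ (n - k) * dyadicAverage k d x ^ 2 := by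
  have hd' : Measurable d := hd.mono (dyadicFiltration.le n) le_rfl
  simp only [dyadicAverage_eq_mul_lintegral k fun y => d y ^ 2]
  calc 2 ^ k * ∫⁻ y in dyadicInterval k 0, d (x + y) ^ 2 ∂haar
      ≤ 2 ^ k * ∫⁻ y in dyadicInterval k 0,
          (2 ^ (n - k) * dyadicAverage k d x) * d (x + y) ∂haar := by
        gcongr 2 ^ k * ?_
        refine setLIntegral_mono (by fun_prop) fun y hy => ?_
        rw [pow_two]
        gcongr
        exact le_two_pow_mul_dyadicAverage hd x hy
    _ = 2 ^ (n - k) * dyadicAverage k d x ^ 2 := by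
        rw [lintegral_const_mul _ (by fun_prop), mul_left_comm, ← dyadicAverage_eq_mul_lintegral,
          mul_assoc, pow_two]

/-! ### Fejér means of dyadic martingales -/

theorem countable_range_dyadicInterval (n : ℕ) : (Set.range (dyadicInterval n)).Countable := by
  refine (Set.countable_range fun p : Fin n → ZMod 2 => {y : G | ∀ i : Fin n, y i = p i}).mono ?_
  rintro _ ⟨x, rfl⟩
  exact ⟨fun i => x i, by ext y; simp [dyadicInterval, Fin.forall_iff]⟩

theorem measurable_of_eq_of_mem_dyadicInterval {β : Type*} [MeasurableSpace β] {n : ℕ} {f : G → β}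
    (hf : ∀ x, ∀ y ∈ dyadicInterval n x, f y = f x) : Measurable[dyadicFiltration n] f := by
  intro s _
  have h_union : f ⁻¹' s = ⋃₀ {I ∈ Set.range (dyadicInterval n) | I ⊆ f ⁻¹' s} := by
    refine Set.Subset.antisymm (fun x hx => ?_) (Set.sUnion_subset fun I hI => hI.2)
    refine ⟨dyadicInterval n x, ⟨⟨x, rfl⟩, fun y hy => ?_⟩, fun _ _ => rfl⟩
    rwa [Set.mem_preimage, hf x y hy]
  rw [h_union]
  exact MeasurableSet.sUnion ((countable_range_dyadicInterval n).mono fun I hI => hI.1)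
    fun I hI => MeasurableSpace.measurableSet_generateFrom hI.1

theorem measurable_dyadicFiltration_walsh {i m : ℕ} (hi : i < 2 ^ m) :
    Measurable[dyadicFiltration m] (walsh i) := by
  refine measurable_of_eq_of_mem_dyadicInterval fun x y hy => ?_
  rw [walsh_eq_prod_range hi, walsh_eq_prod_range hi]
  exact Finset.prod_congr rfl fun k hk => by
    rw [rademacher, rademacher, hy k (Finset.mem_range.mp hk)]

@[fun_prop]
theorem measurable_walsh (i : ℕ) : Measurable (walsh i) :=
  (measurable_dyadicFiltration_walsh Nat.lt_two_pow_self).mono (dyadicFiltration.le i) le_rfl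

theorem integrable_mul_walsh {f : G → ℝ} (hf : Integrable f haar) (i : ℕ) :
    Integrable (fun x => f x * walsh i x) haar :=
  hf.mul_bdd (c := 1) (measurable_walsh i).aestronglyMeasurable
    (ae_of_all _ fun x => (abs_walsh i x).le)

section Martingale

variable {F : ℕ → G → ℝ} (hF : Martingale F dyadicFiltration haar)

include hF

theorem measurable_of_martingale (n : ℕ) : Measurable[dyadicFiltration n] (F n) :=
  (hF.1 n).measurable

theorem integral_mul_walsh_of_le {i m n : ℕ} (hi : i < 2 ^ m) (hmn : m ≤ n) :
    ∫ x, F n x * walsh i x ∂haar = ∫ x, F m x * walsh i x ∂haar := by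
  have pull_out : haar[F n * walsh i | dyadicFiltration m] =ᵐ[haar]
      haar[F n | dyadicFiltration m] * walsh i :=
    condExp_mul_of_stronglyMeasurable_right
      (measurable_dyadicFiltration_walsh hi).stronglyMeasurable
      (integrable_mul_walsh (hF.integrable n) i) (hF.integrable n)
  have h_condExp : haar[F n * walsh i | dyadicFiltration m] =ᵐ[haar] F m * walsh i := by
    filter_upwards [pull_out, hF.2 m n hmn] with x h_pull h_mart
    rw [h_pull, Pi.mul_apply, Pi.mul_apply, h_mart]
  calc ∫ x, F n x * walsh i x ∂haar
      = ∫ x, (haar[F n * walsh i | dyadicFiltration m]) x ∂haar :=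
        (integral_condExp (dyadicFiltration.le m)).symm
    _ = ∫ x, F m x * walsh i x ∂haar := integral_congr_ae h_condExp

theorem fourierCoeff_eq_integral {i m : ℕ} (hi : i < 2 ^ m) :
    fourierCoeff F i = ∫ x, F m x * walsh i x ∂haar := by
  refine Tendsto.limUnder_eq (tendsto_const_nhds.congr' ?_)
  filter_upwards [eventually_ge_atTop m] with n hn
  exact (integral_mul_walsh_of_le hF hi hn).symm

theorem fourierCoeff_mul_walsh_eq_integral {i m : ℕ} (hi : i < 2 ^ m) (x : G) :
    fourierCoeff F i * walsh i x = ∫ y, F m (x + y) * walsh i y ∂haar := by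
  have h_sq : walsh i x * walsh i x = 1 := by
    rw [← abs_mul_abs_self, abs_walsh, one_mul]
  rw [fourierCoeff_eq_integral hF hi,
    ← integral_add_left_eq_self (fun y => F m y * walsh i y) x, ← integral_mul_const]
  refine integral_congr_ae (ae_of_all _ fun y => ?_)
  simp only [walsh_add]
  linear_combination F m (x + y) * walsh i y * h_sq

theorem integrable_translate_mul_dirichletKernel (m n : ℕ) (x : G) :
    Integrable (fun y => F m (x + y) * dirichletKernel n y) haar := by
  simp only [dirichletKernel, Finset.mul_sum]
  exact integrable_finsetSum _ fun i _ =>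
    integrable_mul_walsh ((hF.integrable m).comp_add_left x) i

theorem partialSum_eq_integral {m n : ℕ} (hn : n ≤ 2 ^ m) (x : G) :
    partialSum F n x = ∫ y, F m (x + y) * dirichletKernel n y ∂haar := by
  simp only [partialSum, dirichletKernel, Finset.mul_sum]
  rw [integral_finsetSum _ fun i _ =>
    integrable_mul_walsh ((hF.integrable m).comp_add_left x) i]
  exact Finset.sum_congr rfl fun i hi =>
    fourierCoeff_mul_walsh_eq_integral hF ((Finset.mem_range.mp hi).trans_le hn) x

theorem natCast_mul_fejerMean_eq_integral {m N : ℕ} (hN : N ≤ 2 ^ m) (x : G) :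
    N * fejerMean F N x = ∫ y, F m (x + y) * fejerSum N y ∂haar := by
  rcases N.eq_zero_or_pos with rfl | hN_pos
  · simp [fejerSum]
  have h_partialSum : ∀ k ∈ Finset.range N,
      partialSum F (1 + k) x = ∫ y, F m (x + y) * dirichletKernel (k + 1) y ∂haar := by
    intro k hk
    rw [add_comm, partialSum_eq_integral hF ((Finset.mem_range.mp hk).trans_le hN)]
  rw [fejerMean, ← mul_assoc, mul_one_div_cancel (by positivity), one_mul,
    ← Finset.Ico_add_one_right_eq_Icc, Finset.sum_Ico_eq_sum_range, Nat.add_sub_cancel,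
    Finset.sum_congr rfl h_partialSum]
  simp only [fejerSum, Finset.mul_sum]
  rw [integral_finsetSum _ fun k _ => integrable_translate_mul_dirichletKernel hF m (k + 1) x]

end Martingale

/-! ### Integration against the Fejér majorant -/

@[fun_prop]
theorem measurable_dirichletKernel (n : ℕ) : Measurable (dirichletKernel n) :=
  Finset.measurable_fun_sum _ fun i _ => measurable_walsh i

/-- The measure with density `2^{-m} fejerMajorant m`; for `2^{m-1} ≤ N < 2^m` this density is at
least `|K_N| / 4`. -/
noncomputable def majorantMeasure (m : ℕ) : Measure G :=
  haar.withDensity fun y => 2⁻¹ ^ m * ENNReal.ofReal (fejerMajorant m y)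

@[fun_prop]
theorem measurable_fejerMajorant (m : ℕ) : Measurable (fejerMajorant m) := by
  unfold fejerMajorant fejerBlock
  fun_prop

theorem lintegral_majorantMeasure_eq_mul (m : ℕ) {f : G → ℝ≥0∞} (hf : Measurable f) :
    ∫⁻ y, f y ∂majorantMeasure m =
      2⁻¹ ^ m * ∫⁻ y, f y * ENNReal.ofReal (fejerMajorant m y) ∂haar := by
  rw [majorantMeasure, lintegral_withDensity_eq_lintegral_mul _ (by fun_prop) hf,
    ← lintegral_const_mul' _ _ (by finiteness)]
  simp only [Pi.mul_apply, mul_assoc, mul_comm (f _)]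

theorem ofReal_fejerMajorant (m : ℕ) (y : G) :
    ENNReal.ofReal (fejerMajorant m y) = ∑ k ∈ Finset.range m, ∑ j ∈ Finset.range (k + 1),
      2 ^ j * ENNReal.ofReal (dirichletKernel (2 ^ k) (y + unitVec j)) := by
  rw [fejerMajorant, ENNReal.ofReal_sum_of_nonneg fun k _ => fejerBlock_nonneg k y]
  refine Finset.sum_congr rfl fun k _ => ?_
  rw [fejerBlock, ENNReal.ofReal_sum_of_nonneg fun j _ =>
    mul_nonneg (by positivity) (dirichletKernel_two_pow_nonneg _ _)]
  refine Finset.sum_congr rfl fun j _ => ?_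
  rw [ENNReal.ofReal_mul (by positivity), ENNReal.ofReal_pow zero_le_two, ENNReal.ofReal_ofNat]

theorem lintegral_mul_dirichletKernel_two_pow (k : ℕ) (f : G → ℝ≥0∞) (x : G) :
    ∫⁻ y, f (x + y) * ENNReal.ofReal (dirichletKernel (2 ^ k) y) ∂haar = dyadicAverage k f x := by
  have h_indicator : ∀ y, f (x + y) * ENNReal.ofReal (dirichletKernel (2 ^ k) y) =
      (dyadicInterval k 0).indicator (fun y => 2 ^ k * f (x + y)) y := fun y => by
    rw [dirichletKernel_two_pow]
    by_cases hy : y ∈ dyadicInterval k 0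
    · simp [hy, mul_comm, ENNReal.ofReal_pow]
    · simp [hy]
  simp only [h_indicator]
  rw [lintegral_indicator (measurableSet_dyadicInterval k 0),
    lintegral_const_mul' _ _ (by finiteness), dyadicAverage_eq_mul_lintegral]

theorem lintegral_mul_dirichletKernel_two_pow_add_unitVec (k j : ℕ) (f : G → ℝ≥0∞) (x : G) :
    ∫⁻ y, f (x + y) * ENNReal.ofReal (dirichletKernel (2 ^ k) (y + unitVec j)) ∂haar =
      dyadicAverage k f (x + unitVec j) := by
  rw [← lintegral_mul_dirichletKernel_two_pow, ← lintegral_add_right_eq_self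
    (fun y => f (x + unitVec j + y) * ENNReal.ofReal (dirichletKernel (2 ^ k) y)) (unitVec j)]
  simp only [add_add_add_comm x (unitVec j), ZModModule.add_self, add_zero]

theorem lintegral_majorantMeasure (m : ℕ) {f : G → ℝ≥0∞} (hf : Measurable f) (x : G) :
    ∫⁻ y, f (x + y) ∂majorantMeasure m = 2⁻¹ ^ m * ∑ k ∈ Finset.range m,
      ∑ j ∈ Finset.range (k + 1), 2 ^ j * dyadicAverage k f (x + unitVec j) := by
  rw [lintegral_majorantMeasure_eq_mul m (by fun_prop)]
  congr 1
  simp only [ofReal_fejerMajorant, Finset.mul_sum]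
  rw [lintegral_finsetSum _ (by fun_prop)]
  refine Finset.sum_congr rfl fun k _ => ?_
  rw [lintegral_finsetSum _ (by fun_prop)]
  refine Finset.sum_congr rfl fun j _ => ?_
  simp only [mul_left_comm (f _)]
  rw [lintegral_const_mul' _ _ (by finiteness),
    lintegral_mul_dirichletKernel_two_pow_add_unitVec]

/-- The ratio `3/4` of the geometric weights below. Any ratio in `[2^{-1/2}, 1)` would do: the
kernel weights `2^{j-k}` enter through their square roots. -/
noncomputable def decayRatio : ℝ≥0∞ := 3 / 4

theorem decayRatio_le_one : decayRatio ≤ 1 :=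
  ENNReal.div_le_of_le_mul (by norm_num)

theorem inv_two_le_decayRatio_sq : 2⁻¹ ≤ decayRatio ^ 2 := by
  rw [decayRatio, ← ENNReal.toReal_le_toReal (by finiteness) (by finiteness)]
  norm_num

theorem tsum_decayRatio_pow : ∑' i : ℕ, decayRatio ^ i = 4 := by
  have h_sub : 1 - decayRatio = 4⁻¹ := by
    refine ENNReal.sub_eq_of_eq_add (decayRatio_le_one.trans_lt ENNReal.one_lt_top).ne ?_
    rw [decayRatio, ← ENNReal.toReal_eq_toReal_iff' (by finiteness) (by finiteness),
      ENNReal.toReal_add (by finiteness) (by finiteness)]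
    norm_num
  rw [ENNReal.tsum_geometric, h_sub, inv_inv]

theorem sum_decayRatio_pow_le (k : ℕ) :
    ∑ j ∈ Finset.range (k + 1), decayRatio ^ (k - j) ≤ 4 := by
  rw [Finset.sum_flip fun i => decayRatio ^ i, ← tsum_decayRatio_pow]
  exact ENNReal.sum_le_tsum _

/-- The geometrically weighted sum `Σ_{j ≤ k} ρ^{k-j} E_k d(x + e_j)` of translates of the dyadic
average `E_k d`, where `ρ` is `decayRatio`. -/
noncomputable def translateSum (k : ℕ) (d : G → ℝ≥0∞) (x : G) : ℝ≥0∞ :=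
  ∑ j ∈ Finset.range (k + 1), decayRatio ^ (k - j) * dyadicAverage k d (x + unitVec j)

theorem measurable_translateSum (k : ℕ) {d : G → ℝ≥0∞} (hd : Measurable d) :
    Measurable (translateSum k d) :=
  Finset.measurable_fun_sum _ fun _ _ =>
    ((measurable_dyadicAverage k hd).comp (measurable_add_const _)).const_mul _

theorem lintegral_translateSum_le (k : ℕ) {d : G → ℝ≥0∞} (hd : Measurable d) :
    ∫⁻ x, translateSum k d x ∂haar ≤ 4 * ∫⁻ x, d x ∂haar := by
  have hE := measurable_dyadicAverage k hd
  calc ∫⁻ x, translateSum k d x ∂haar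
      = ∑ j ∈ Finset.range (k + 1), decayRatio ^ (k - j) * ∫⁻ x, d x ∂haar := by
        unfold translateSum
        rw [lintegral_finsetSum _ (by fun_prop)]
        refine Finset.sum_congr rfl fun j _ => ?_
        rw [lintegral_const_mul _ (by fun_prop), lintegral_add_right_eq_self _ (unitVec j),
          lintegral_dyadicAverage k hd]
    _ ≤ 4 * ∫⁻ x, d x ∂haar := by
        rw [← Finset.sum_mul]
        gcongr
        exact sum_decayRatio_pow_le k

theorem inv_two_pow_mul_two_pow_le {j k n m : ℕ} (hjk : j ≤ k) (hkm : k ≤ m) (hnm : n ≤ m) :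
    (2⁻¹ : ℝ≥0∞) ^ m * (2 ^ j * 2 ^ (n - k)) ≤ (decayRatio ^ (k - j)) ^ 2 := by
  calc (2⁻¹ : ℝ≥0∞) ^ m * (2 ^ j * 2 ^ (n - k))
      ≤ 2⁻¹ ^ (k - j + (j + (n - k))) * 2 ^ (j + (n - k)) := by
        rw [← pow_add]
        gcongr ?_ * _
        exact pow_le_pow_right_of_le_one' (by norm_num) (by omega)
    _ = 2⁻¹ ^ (k - j) := by
        rw [pow_add, mul_assoc, mul_comm (2⁻¹ ^ _) (2 ^ _), two_pow_mul_inv_two_pow, mul_one]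
    _ ≤ (decayRatio ^ (k - j)) ^ 2 := by
        rw [pow_right_comm]
        gcongr
        exact inv_two_le_decayRatio_sq

theorem lintegral_sq_majorantMeasure_le {n m : ℕ} (hnm : n ≤ m) {d : G → ℝ≥0∞}
    (hd : Measurable[dyadicFiltration n] d) (x : G) :
    ∫⁻ y, d (x + y) ^ 2 ∂majorantMeasure m ≤ (∑ k ∈ Finset.range m, translateSum k d x) ^ 2 := by
  have hd' : Measurable d := hd.mono (dyadicFiltration.le n) le_rfl
  have h_term : ∀ k ∈ Finset.range m, ∀ j ∈ Finset.range (k + 1),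
      2⁻¹ ^ m * (2 ^ j * dyadicAverage k (fun y => d y ^ 2) (x + unitVec j)) ≤
        (decayRatio ^ (k - j) * dyadicAverage k d (x + unitVec j)) ^ 2 := by
    intro k hk j hj
    calc 2⁻¹ ^ m * (2 ^ j * dyadicAverage k (fun y => d y ^ 2) (x + unitVec j))
        ≤ 2⁻¹ ^ m * (2 ^ j * (2 ^ (n - k) * dyadicAverage k d (x + unitVec j) ^ 2)) := by
          gcongr
          exact dyadicAverage_sq_le k hd _
      _ = 2⁻¹ ^ m * (2 ^ j * 2 ^ (n - k)) * dyadicAverage k d (x + unitVec j) ^ 2 := by ring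
      _ ≤ (decayRatio ^ (k - j) * dyadicAverage k d (x + unitVec j)) ^ 2 := by
          rw [mul_pow]
          gcongr
          exact inv_two_pow_mul_two_pow_le (Finset.mem_range_succ_iff.mp hj)
            (Finset.mem_range.mp hk).le hnm
  rw [lintegral_majorantMeasure m (hd'.pow_const 2)]
  simp only [Finset.mul_sum]
  calc ∑ k ∈ Finset.range m, ∑ j ∈ Finset.range (k + 1),
        2⁻¹ ^ m * (2 ^ j * dyadicAverage k (fun y => d y ^ 2) (x + unitVec j))
      ≤ ∑ k ∈ Finset.range m, ∑ j ∈ Finset.range (k + 1),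
          (decayRatio ^ (k - j) * dyadicAverage k d (x + unitVec j)) ^ 2 :=
        Finset.sum_le_sum fun k hk => Finset.sum_le_sum (h_term k hk)
    _ ≤ ∑ k ∈ Finset.range m, translateSum k d x ^ 2 :=
        Finset.sum_le_sum fun k _ => Finset.sum_sq_le_sq_sum_of_nonneg fun _ _ => zero_le
    _ ≤ (∑ k ∈ Finset.range m, translateSum k d x) ^ 2 :=
        Finset.sum_sq_le_sq_sum_of_nonneg fun _ _ => zero_le

theorem translateSum_le_of_le {n k : ℕ} (h : n ≤ k) {d : G → ℝ≥0∞}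
    (hd : Measurable[dyadicFiltration n] d) (x : G) :
    translateSum k d x ≤ 4 * d x + translateSum n d x := by
  have h_near : ∀ j ∈ Finset.Ico n (k + 1), decayRatio ^ (k - j) * d (x + unitVec j) =
      decayRatio ^ (k - j) * d x := fun j hj => by
    rw [eq_of_mem_dyadicInterval hd (add_unitVec_mem_dyadicInterval (Finset.mem_Ico.mp hj).1 x)]
  simp only [translateSum, dyadicAverage_of_le h hd, dyadicAverage_of_le le_rfl hd]
  rw [← Finset.sum_range_add_sum_Ico _ (Nat.le_succ_of_le h), add_comm, Finset.sum_congr rfl h_near,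
    ← Finset.sum_mul]
  gcongr ?_ * _ + ?_
  · refine le_trans ?_ (sum_decayRatio_pow_le k)
    exact Finset.sum_le_sum_of_subset fun j hj =>
      Finset.mem_range.mpr (Finset.mem_Ico.mp hj).2
  · refine le_trans ?_ (Finset.sum_le_sum_of_subset (Finset.range_mono n.le_succ))
    refine Finset.sum_le_sum fun j _ => ?_
    gcongr ?_ * _
    exact pow_le_pow_right_of_le_one' decayRatio_le_one (by omega)

/-! ### Increments of the running maximum -/

/-- A majorant of `m⁻¹ Σ_{k < m} translateSum k d` for every `m ≥ n`, when `d` is constant on the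
dyadic intervals of rank `n`. -/
noncomputable def translateMajorant (n : ℕ) (d : G → ℝ≥0∞) (x : G) : ℝ≥0∞ :=
  4 * d x + translateSum n d x + (n : ℝ≥0∞)⁻¹ * ∑ k ∈ Finset.range n, translateSum k d x

theorem measurable_translateMajorant (n : ℕ) {d : G → ℝ≥0∞} (hd : Measurable d) :
    Measurable (translateMajorant n d) :=
  ((hd.const_mul 4).add (measurable_translateSum n hd)).add
    ((Finset.measurable_fun_sum _ fun k _ => measurable_translateSum k hd).const_mul _)

theorem sum_translateSum_le {n m : ℕ} (h : n ≤ m) {d : G → ℝ≥0∞}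
    (hd : Measurable[dyadicFiltration n] d) (x : G) :
    ∑ k ∈ Finset.range m, translateSum k d x ≤ m * translateMajorant n d x := by
  have h_tail : ∑ k ∈ Finset.Ico n m, translateSum k d x ≤
      m * (4 * d x + translateSum n d x) := by
    refine (Finset.sum_le_card_nsmul _ _ _ fun k hk =>
      translateSum_le_of_le (Finset.mem_Ico.mp hk).1 hd x).trans ?_
    rw [nsmul_eq_mul, Nat.card_Ico]
    gcongr
    exact Nat.sub_le m n
  have h_head : ∑ k ∈ Finset.range n, translateSum k d x ≤
      m * ((n : ℝ≥0∞)⁻¹ * ∑ k ∈ Finset.range n, translateSum k d x) := by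
    rcases n.eq_zero_or_pos with rfl | hn
    · simp
    · rw [← mul_assoc]
      refine le_mul_of_one_le_left' ?_
      rw [← ENNReal.mul_inv_cancel (Nat.cast_ne_zero.mpr hn.ne') (ENNReal.natCast_ne_top n)]
      gcongr
  rw [translateMajorant, mul_add, ← Finset.sum_range_add_sum_Ico _ h, add_comm]
  exact add_le_add h_tail h_head

theorem lintegral_translateMajorant_le (n : ℕ) {d : G → ℝ≥0∞} (hd : Measurable d) :
    ∫⁻ x, translateMajorant n d x ∂haar ≤ 12 * ∫⁻ x, d x ∂haar := by
  have hT := fun k => measurable_translateSum k hd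
  have h_average : (n : ℝ≥0∞)⁻¹ * ∑ k ∈ Finset.range n, ∫⁻ x, translateSum k d x ∂haar ≤
      4 * ∫⁻ x, d x ∂haar := by
    rw [← ENNReal.div_eq_inv_mul]
    refine ENNReal.div_le_of_le_mul ?_
    refine (Finset.sum_le_card_nsmul _ _ _ fun k _ => lintegral_translateSum_le k hd).trans_eq ?_
    rw [nsmul_eq_mul, Finset.card_range, mul_comm]
  calc ∫⁻ x, translateMajorant n d x ∂haar
      = 4 * ∫⁻ x, d x ∂haar + ∫⁻ x, translateSum n d x ∂haar +
          (n : ℝ≥0∞)⁻¹ * ∑ k ∈ Finset.range n, ∫⁻ x, translateSum k d x ∂haar := by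
        unfold translateMajorant
        rw [lintegral_add_left (by fun_prop), lintegral_add_left (by fun_prop),
          lintegral_const_mul _ hd, lintegral_const_mul _ (by fun_prop),
          lintegral_finsetSum _ fun k _ => hT k]
    _ ≤ 4 * ∫⁻ x, d x ∂haar + 4 * ∫⁻ x, d x ∂haar + 4 * ∫⁻ x, d x ∂haar := by
        gcongr
        exact lintegral_translateSum_le n hd
    _ = 12 * ∫⁻ x, d x ∂haar := by ring

/-- The maximum of `u_0, …, u_{n-1}`, which is `0` for `n = 0`. -/
noncomputable def runningMax (u : ℕ → G → ℝ≥0∞) (n : ℕ) (x : G) : ℝ≥0∞ := ⨆ i < n, u i x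

/-- The amount by which `u_n` raises the running maximum. -/
noncomputable def maxIncrement (u : ℕ → G → ℝ≥0∞) (n : ℕ) (x : G) : ℝ≥0∞ :=
  runningMax u (n + 1) x - runningMax u n x

section Increments

variable (u : ℕ → G → ℝ≥0∞)

theorem runningMax_le_iSup (n : ℕ) (x : G) : runningMax u n x ≤ ⨆ i, u i x :=
  iSup₂_le_iSup _ _

theorem le_runningMax_succ (n : ℕ) (x : G) : u n x ≤ runningMax u (n + 1) x :=
  le_iSup₂_of_le n n.lt_succ_self le_rfl

theorem runningMax_le_succ (n : ℕ) (x : G) : runningMax u n x ≤ runningMax u (n + 1) x :=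
  biSup_mono fun _ hi => hi.trans n.lt_succ_self

theorem sum_maxIncrement (n : ℕ) (x : G) :
    ∑ i ∈ Finset.range n, maxIncrement u i x = runningMax u n x := by
  induction n with
  | zero => simp [runningMax]
  | succ n ih =>
    rw [Finset.sum_range_succ, ih, maxIncrement, add_tsub_cancel_of_le (runningMax_le_succ u n x)]

theorem tsum_maxIncrement_le (x : G) : ∑' n, maxIncrement u n x ≤ ⨆ n, u n x :=
  ENNReal.tsum_le_of_sum_range_le fun n => (sum_maxIncrement u n x).trans_le
    (runningMax_le_iSup u n x)

variable {u} (hu : ∀ n, Measurable[dyadicFiltration n] (u n))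

include hu

theorem measurable_runningMax {n m : ℕ} (h : n ≤ m + 1) :
    Measurable[dyadicFiltration m] (runningMax u n) :=
  Measurable.iSup fun i => Measurable.iSup fun hi =>
    (hu i).mono (dyadicFiltration.mono (by omega)) le_rfl

theorem measurable_maxIncrement (n : ℕ) : Measurable[dyadicFiltration n] (maxIncrement u n) :=
  (measurable_runningMax hu le_rfl).sub (measurable_runningMax hu n.le_succ)

end Increments

/-- The sum of the translate majorants of the increments of the running maximum. For
`u_n = |F_n|^{1/2}` it controls all the weighted Fejér means at once. -/
noncomputable def incrementMajorant (u : ℕ → G → ℝ≥0∞) (x : G) : ℝ≥0∞ :=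
  ∑' n, translateMajorant n (maxIncrement u n) x

theorem lintegral_incrementMajorant_le {u : ℕ → G → ℝ≥0∞}
    (hu : ∀ n, Measurable[dyadicFiltration n] (u n)) :
    ∫⁻ x, incrementMajorant u x ∂haar ≤ 12 * ∫⁻ x, ⨆ n, u n x ∂haar := by
  have hd := fun n => (measurable_maxIncrement hu n).mono (dyadicFiltration.le n) le_rfl
  calc ∫⁻ x, incrementMajorant u x ∂haar
      = ∑' n, ∫⁻ x, translateMajorant n (maxIncrement u n) x ∂haar :=
        lintegral_tsum fun n => (measurable_translateMajorant n (hd n)).aemeasurable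
    _ ≤ ∑' n, 12 * ∫⁻ x, maxIncrement u n x ∂haar :=
        ENNReal.tsum_le_tsum fun n => lintegral_translateMajorant_le n (hd n)
    _ = 12 * ∫⁻ x, ∑' n, maxIncrement u n x ∂haar := by
        rw [ENNReal.tsum_mul_left, lintegral_tsum fun n => (hd n).aemeasurable]
    _ ≤ 12 * ∫⁻ x, ⨆ n, u n x ∂haar := by
        gcongr with x
        exact tsum_maxIncrement_le u x

theorem lintegral_sq_le_iff_eLpNorm_two_le {α : Type*} [MeasurableSpace α] {μ : Measure α}
    {f : α → ℝ≥0∞} {a : ℝ≥0∞} : ∫⁻ x, f x ^ 2 ∂μ ≤ a ^ 2 ↔ eLpNorm f 2 μ ≤ a := by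
  rw [eLpNorm_eq_lintegral_rpow_enorm_toReal two_ne_zero ENNReal.ofNat_ne_top]
  simp [ENNReal.rpow_inv_le_iff]

theorem lintegral_sum_sq_le {α ι : Type*} [MeasurableSpace α] {μ : Measure α} {s : Finset ι}
    {f : ι → α → ℝ≥0∞} {a : ι → ℝ≥0∞} (hf : ∀ i ∈ s, AEStronglyMeasurable (f i) μ)
    (h : ∀ i ∈ s, ∫⁻ x, f i x ^ 2 ∂μ ≤ a i ^ 2) :
    ∫⁻ x, (∑ i ∈ s, f i x) ^ 2 ∂μ ≤ (∑ i ∈ s, a i) ^ 2 := by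
  simp only [← Finset.sum_apply]
  rw [lintegral_sq_le_iff_eLpNorm_two_le]
  exact (eLpNorm_sum_le hf (by norm_num)).trans
    (Finset.sum_le_sum fun i hi => lintegral_sq_le_iff_eLpNorm_two_le.mp (h i hi))

theorem lintegral_sq_le_incrementMajorant {u : ℕ → G → ℝ≥0∞}
    (hu : ∀ n, Measurable[dyadicFiltration n] (u n)) (m : ℕ) (x : G) :
    ∫⁻ y, u m (x + y) ^ 2 ∂majorantMeasure m ≤ (m * incrementMajorant u x) ^ 2 := by
  have hd := measurable_maxIncrement hu
  have hd' := fun n => (hd n).mono (dyadicFiltration.le n) le_rfl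
  have h_increment : ∀ n ∈ Finset.range (m + 1),
      ∫⁻ y, maxIncrement u n (x + y) ^ 2 ∂majorantMeasure m ≤
        (m * translateMajorant n (maxIncrement u n) x) ^ 2 := by
    intro n hn
    have hnm : n ≤ m := Finset.mem_range_succ_iff.mp hn
    refine (lintegral_sq_majorantMeasure_le hnm (hd n) x).trans ?_
    gcongr
    exact sum_translateSum_le hnm (hd n) x
  calc ∫⁻ y, u m (x + y) ^ 2 ∂majorantMeasure m
      ≤ ∫⁻ y, (∑ n ∈ Finset.range (m + 1), maxIncrement u n (x + y)) ^ 2 ∂majorantMeasure m := by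
        gcongr with y
        rw [sum_maxIncrement]
        exact le_runningMax_succ u m (x + y)
    _ ≤ (∑ n ∈ Finset.range (m + 1), m * translateMajorant n (maxIncrement u n) x) ^ 2 :=
        lintegral_sum_sq_le
          (fun n _ => ((hd' n).comp (measurable_const_add x)).aestronglyMeasurable) h_increment
    _ ≤ (m * incrementMajorant u x) ^ 2 := by
        rw [← Finset.mul_sum]
        gcongr
        exact ENNReal.sum_le_tsum _

/-! ### Maximal Fejér operators -/

/-- The weighted maximal operator `sup_{n ≥ 2} |σ_n F| / log² n` of all Fejér means (with values in
`[0, ∞]`). -/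
noncomputable def fejerMaximal (F : ℕ → G → ℝ) (x : G) : ℝ≥0∞ :=
  ⨆ (n : ℕ) (_ : 2 ≤ n), ENNReal.ofReal (|fejerMean F n x| / Real.log n ^ 2)

@[fun_prop]
theorem measurable_fejerMean (F : ℕ → G → ℝ) (n : ℕ) : Measurable (fejerMean F n) := by
  unfold fejerMean partialSum
  fun_prop

theorem measurable_fejerMaximal (F : ℕ → G → ℝ) : Measurable (fejerMaximal F) := by
  unfold fejerMaximal
  fun_prop

theorem measurable_restrictedMaximal (F : ℕ → G → ℝ) : Measurable (restrictedMaximal F) := by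
  unfold restrictedMaximal
  fun_prop

theorem two_le_betaNum {s k : ℕ} (h : k < s) : 2 ≤ betaNum s k :=
  calc 2 ≤ 2 ^ s := Nat.le_self_pow (by omega) 2
    _ ≤ betaNum s k := Finset.single_le_sum (f := fun j => 2 ^ j) (fun _ _ => Nat.zero_le _)
        (Finset.right_mem_Icc.mpr h.le)

theorem restrictedMaximal_le_fejerMaximal (F : ℕ → G → ℝ) (x : G) :
    restrictedMaximal F x ≤ fejerMaximal F x :=
  iSup_le fun s => iSup₂_le fun k hk => le_iSup₂_of_le (betaNum s k) (two_le_betaNum hk) le_rfl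

theorem eLpNorm_restrictedMaximal_le (F : ℕ → G → ℝ) (p : ℝ≥0∞) :
    eLpNorm (restrictedMaximal F) p haar ≤ eLpNorm (fejerMaximal F) p haar :=
  eLpNorm_mono_enorm (restrictedMaximal_le_fejerMaximal F)

theorem memLp_restrictedMaximal {F : ℕ → G → ℝ} {p : ℝ≥0∞} (h : MemLp (fejerMaximal F) p haar) :
    MemLp (restrictedMaximal F) p haar :=
  ⟨(measurable_restrictedMaximal F).aestronglyMeasurable,
    (eLpNorm_restrictedMaximal_le F p).trans_lt h.2⟩

theorem size_le_four_mul_log {N : ℕ} (hN : 2 ≤ N) : (N.size : ℝ) ≤ 4 * Real.log N := by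
  obtain ⟨l, hl⟩ : ∃ l, N.size = l + 2 := Nat.exists_eq_add_of_le' (Nat.lt_size.mpr hN)
  have h_pow : 2 ^ (l + 1) ≤ N := Nat.lt_size.mp (by omega)
  have h_log : ((l + 1 : ℕ) : ℝ) * Real.log 2 ≤ Real.log N := by
    rw [← Real.log_pow]
    exact Real.log_le_log (by positivity) (by exact_mod_cast h_pow)
  rw [hl]
  push_cast at h_log ⊢
  nlinarith [Real.log_two_gt_d9, (Nat.cast_nonneg l : (0 : ℝ) ≤ l)]

theorem eLpNorm_half {α : Type*} [MeasurableSpace α] (μ : Measure α) (g : α → ℝ≥0∞) :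
    eLpNorm g (1 / 2) μ = (∫⁻ x, g x ^ (1 / 2 : ℝ) ∂μ) ^ 2 := by
  rw [eLpNorm_eq_lintegral_rpow_enorm_toReal (by simp) (by simp)]
  simp

theorem rpow_half_sq (a : ℝ≥0∞) : (a ^ (1 / 2 : ℝ)) ^ 2 = a := by
  rw [← ENNReal.rpow_mul_natCast]
  norm_num

section Martingale

variable {F : ℕ → G → ℝ} (hF : Martingale F dyadicFiltration haar)

include hF

theorem enorm_fejerMean_le {N m : ℕ} (hN : N < 2 ^ m) (hm : 2 ^ m ≤ 2 * N) (x : G) :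
    ‖fejerMean F N x‖ₑ ≤ 4 * ∫⁻ y, ‖F m (x + y)‖ₑ ∂majorantMeasure m := by
  have hFm : Measurable (F m) := (measurable_of_martingale hF m).mono (dyadicFiltration.le m) le_rfl
  have hN_ne : (N : ℝ≥0∞) ≠ 0 := by
    have := Nat.two_pow_pos m
    exact_mod_cast (by omega : N ≠ 0)
  have h_majorant : ∫⁻ y, ‖F m (x + y)‖ₑ * ENNReal.ofReal (fejerMajorant m y) ∂haar =
      2 ^ m * ∫⁻ y, ‖F m (x + y)‖ₑ ∂majorantMeasure m := by
    rw [lintegral_majorantMeasure_eq_mul m (by fun_prop), ← mul_assoc, two_pow_mul_inv_two_pow,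
      one_mul]
  refine (ENNReal.mul_le_mul_iff_right hN_ne (ENNReal.natCast_ne_top N)).mp ?_
  calc N * ‖fejerMean F N x‖ₑ
      = ‖∫ y, F m (x + y) * fejerSum N y ∂haar‖ₑ := by
        rw [← natCast_mul_fejerMean_eq_integral hF hN.le, enorm_mul,
          Real.enorm_natCast]
    _ ≤ ∫⁻ y, ‖F m (x + y) * fejerSum N y‖ₑ ∂haar := enorm_integral_le_lintegral_enorm _
    _ ≤ ∫⁻ y, 2 * (‖F m (x + y)‖ₑ * ENNReal.ofReal (fejerMajorant m y)) ∂haar := by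
        gcongr with y
        rw [enorm_mul, mul_left_comm, Real.enorm_eq_ofReal_abs (fejerSum N y),
          ← ENNReal.ofReal_ofNat 2, ← ENNReal.ofReal_mul zero_le_two]
        gcongr
        exact abs_fejerSum_le hN y
    _ = 2 * (2 ^ m * ∫⁻ y, ‖F m (x + y)‖ₑ ∂majorantMeasure m) := by
        rw [lintegral_const_mul' _ _ (by finiteness), h_majorant]
    _ ≤ 2 * (2 * N * ∫⁻ y, ‖F m (x + y)‖ₑ ∂majorantMeasure m) := by
        gcongr
        exact_mod_cast hm
    _ = N * (4 * ∫⁻ y, ‖F m (x + y)‖ₑ ∂majorantMeasure m) := by ring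

theorem measurable_sqrt_enorm (n : ℕ) :
    Measurable[dyadicFiltration n] fun x => ‖F n x‖ₑ ^ (1 / 2 : ℝ) :=
  (measurable_enorm.pow_const _).comp (measurable_of_martingale hF n)

theorem fejerMaximal_le_sq_incrementMajorant (x : G) :
    fejerMaximal F x ≤ (8 * incrementMajorant (fun n x => ‖F n x‖ₑ ^ (1 / 2 : ℝ)) x) ^ 2 := by
  refine iSup₂_le fun N hN => ?_
  set W := incrementMajorant (fun n x => ‖F n x‖ₑ ^ (1 / 2 : ℝ)) x
  have h_log_pos : 0 < Real.log N := Real.log_pos (by exact_mod_cast hN)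
  have h_size : (N.size : ℝ≥0∞) ≤ 4 * ENNReal.ofReal (Real.log N) := by
    rw [← ENNReal.ofReal_natCast, ← ENNReal.ofReal_ofNat 4, ← ENNReal.ofReal_mul (by norm_num)]
    exact ENNReal.ofReal_le_ofReal (size_le_four_mul_log hN)
  have h_two_pow : 2 ^ N.size ≤ 2 * N := by
    obtain ⟨l, hl⟩ := Nat.exists_eq_add_of_lt (Nat.size_pos.mpr (by omega : 0 < N))
    rw [hl, zero_add, pow_succ']
    exact Nat.mul_le_mul_left 2 (Nat.lt_size.mp (by omega))
  rw [ENNReal.ofReal_div_of_pos (by positivity), ENNReal.ofReal_pow h_log_pos.le,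
    ← Real.enorm_eq_ofReal_abs]
  refine ENNReal.div_le_of_le_mul ?_
  calc ‖fejerMean F N x‖ₑ
      ≤ 4 * ∫⁻ y, ‖F N.size (x + y)‖ₑ ∂majorantMeasure N.size :=
        enorm_fejerMean_le hF (Nat.lt_size_self N) h_two_pow x
    _ = 4 * ∫⁻ y, (‖F N.size (x + y)‖ₑ ^ (1 / 2 : ℝ)) ^ 2 ∂majorantMeasure N.size := by
        simp only [rpow_half_sq]
    _ ≤ 4 * (N.size * W) ^ 2 := by
        gcongr
        exact lintegral_sq_le_incrementMajorant (measurable_sqrt_enorm hF) N.size x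
    _ ≤ 4 * (4 * ENNReal.ofReal (Real.log N) * W) ^ 2 := by gcongr
    _ = (8 * W) ^ 2 * ENNReal.ofReal (Real.log N) ^ 2 := by ring

theorem lintegral_sqrt_fejerMaximal_le :
    ∫⁻ x, fejerMaximal F x ^ (1 / 2 : ℝ) ∂haar ≤
      96 * ∫⁻ x, maximalFunction F x ^ (1 / 2 : ℝ) ∂haar := by
  calc ∫⁻ x, fejerMaximal F x ^ (1 / 2 : ℝ) ∂haar
      ≤ ∫⁻ x, 8 * incrementMajorant (fun n x => ‖F n x‖ₑ ^ (1 / 2 : ℝ)) x ∂haar := by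
        gcongr with x
        rw [one_div, ENNReal.rpow_inv_le_iff two_pos, ENNReal.rpow_ofNat]
        simpa using fejerMaximal_le_sq_incrementMajorant hF x
    _ ≤ 8 * (12 * ∫⁻ x, ⨆ n, ‖F n x‖ₑ ^ (1 / 2 : ℝ) ∂haar) := by
        rw [lintegral_const_mul' _ _ (by finiteness)]
        gcongr
        exact lintegral_incrementMajorant_le (measurable_sqrt_enorm hF)
    _ ≤ 8 * (12 * ∫⁻ x, maximalFunction F x ^ (1 / 2 : ℝ) ∂haar) := by
        gcongr with x
        refine iSup_le fun n => ?_
        gcongr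
        rw [Real.enorm_eq_ofReal_abs]
        exact le_iSup (fun n => ENNReal.ofReal |F n x|) n
    _ = 96 * ∫⁻ x, maximalFunction F x ^ (1 / 2 : ℝ) ∂haar := by ring

end Martingale

end WalshFejer

open WalshFejer in
theorem corollary4_general :
    ∃ C : ℝ≥0, ∀ F : ℕ → G → ℝ, MemHardy (1 / 2) F →
      MemLp (fejerMaximal F) (1 / 2) haar ∧
      eLpNorm (fejerMaximal F) (1 / 2) haar ≤ C * hardyNorm (1 / 2) F := by
  refine ⟨96 ^ 2, fun F hF => ?_⟩
  have h_bound : eLpNorm (fejerMaximal F) (1 / 2) haar ≤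
      ((96 ^ 2 : ℝ≥0) : ℝ≥0∞) * hardyNorm (1 / 2) F := by
    rw [hardyNorm, eLpNorm_half, eLpNorm_half, ENNReal.coe_pow, ← mul_pow]
    gcongr
    exact lintegral_sqrt_fejerMaximal_le hF.martingale
  exact ⟨⟨(measurable_fejerMaximal F).aestronglyMeasurable,
    h_bound.trans_lt (ENNReal.mul_lt_top ENNReal.coe_lt_top hF.norm_lt_top)⟩, h_bound⟩

theorem corollary4 :
    ∃ C : NNReal, ∀ F : ℕ → WalshFejer.G → ℝ, WalshFejer.MemHardy (1 / 2) F →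
      MeasureTheory.MemLp (WalshFejer.restrictedMaximal F) (1 / 2) WalshFejer.haar ∧
      MeasureTheory.eLpNorm (WalshFejer.restrictedMaximal F) (1 / 2) WalshFejer.haar
        ≤ (C : ENNReal) * WalshFejer.hardyNorm (1 / 2) F := by
  obtain ⟨C, hC⟩ := corollary4_general
  exact ⟨C, fun F hF => ⟨WalshFejer.memLp_restrictedMaximal (hC F hF).1,
    (WalshFejer.eLpNorm_restrictedMaximal_le F _).trans (hC F hF).2⟩⟩
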